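/- **Theorem 1.** Let $G_\Delta$ be the infinite triangular grid, in which every node has six neighbours. A *simply connected particle system* is a finite non-empty set $\mathcal P$ of nodes of $G_\Delta$ (the *particles*) such that the subgraphs of $G_\Delta$ induced by $\mathcal P$ and by its complement are both connected. Every particle numbers its six ports, which lead to its six neighbouring nodes, by $\mathbb Z/6$ so that the ports $i$ and $i+1$ lead to adjacent nodes; different particles may use different starting directions and different chiralities. The certificate (register) of a particle marks each of its six ports as *in* or *out*. An edge between two particles $p,q$ is directed from $p$ to $q$ if $p$ marks it as out and $q$ marks it as in; an edge from a particle to a node outside $\mathcal P$ counts as incoming. A configuration (the system with its ports and certificates) is *valid* if every particle $p$ satisfies: * R1: each edge between $p$ and another particle is oriented, both particles agreeing on its direction; * R2: $p$ has at most three outgoing edges; * R3: in the cyclic order of the ports of $p$, the outgoing edges of $p$ are consecutive; * R4: no triangle of three particles that contains $p$ is a directed cycle. A *sink* is a particle with no outgoing edges. Then R1–R4 form a constant-size proof-labelling scheme for leader election, the leader being the sink: 1. (Soundness) Every valid configuration of a simply connected particle system has exactly one sink. 2. (Completeness) For every simply connected particle system and every numbering of the ports there are certificates for which the configuration is valid and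 has no directed cycle. 3. (Constant size and locality) A certificate takes one of $2^6$ values. Whether $p$ satisfies R1–R4 depends only on which nodes at distance at most one from $p$ are occupied and on how the particles at distance at most one from $p$ mark their incident edges, and it is invariant under the symmetries of $G_\Delta$. 4. Directed cycles (necessarily of length greater than three) are not excluded: there is a valid configuration of a simply connected particle system that contains a directed cycle. -/

import Mathlib

/-! ### The triangular grid -/

/-- Nodes of the infinite triangular grid, in axial coordinates. -/
abbrev Node : Type := ℤ × ℤ

/-- The six unit steps of the triangular grid, in cyclic order. -/
def gridSteps : Finset Node :=
  {(1, 0), (0, 1), (-1, 1), (-1, 0), (0, -1), (1, -1)}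

/-- The infinite triangular grid: every node has six neighbours. -/
def triGrid : SimpleGraph Node where
  Adj p q := q - p ∈ gridSteps
  symm := ⟨by
    intro p q h
    have key : ∀ s ∈ gridSteps, -s ∈ gridSteps := by decide
    have h' := key _ h
    rwa [neg_sub] at h'⟩
  loopless := ⟨by
    intro p h
    rw [sub_self] at h
    exact absurd h (by decide)⟩

/-- The support of a simply connected particle system: a finite set of nodes that induces a
connected (in particular non-empty) subgraph and whose complement induces a connected subgraph. -/
def SimplyConnected (P : Finset Node) : Prop :=
  (triGrid.induce (P : Set Node)).Connected ∧ (triGrid.induce (P : Set Node)ᶜ).Connected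

/-! ### Ports, registers, configurations -/

/-- A port labelling: each particle numbers the edges to its six neighbouring nodes by `ZMod 6` so
that ports `i` and `i + 1` lead to neighbouring nodes. Neither the direction of port `0` nor the
chirality has to be the same at different particles. -/
structure PortLabelling where
  port : Node → ZMod 6 → Node
  injective : ∀ p, Function.Injective (port p)
  adj : ∀ p i, triGrid.Adj p (port p i)
  consecutive : ∀ p i, triGrid.Adj (port p i) (port p (i + 1))

/-- The two values that a particle may write for an incident edge. -/
inductive Link where
  | incoming
  | outgoing
deriving DecidableEq

/-- The certificate of a particle: one direction for each of its six ports. -/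
abbrev Register : Type := ZMod 6 → Link

/-- The contents of all registers; only the values at particles are ever used. -/
abbrev Registers : Type := Node → Register

/-- In the register of `p`, the edge from `p` to its neighbouring node `v` is marked outgoing. -/
def MarksOut (L : PortLabelling) (C : Registers) (p v : Node) : Prop :=
  ∃ i, L.port p i = v ∧ C p i = Link.outgoing

/-- The ports of `p` that carry outgoing edges. An edge to an empty node counts as incoming. -/
def outPorts (P : Finset Node) (L : PortLabelling) (C : Registers) (p : Node) : Finset (ZMod 6) :=
  {i | L.port p i ∈ P ∧ C p i = Link.outgoing}

/-- The edge between the particles `p` and `q` is directed from `p` to `q`, and both particles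
agree on that. -/
def DirectedEdge (P : Finset Node) (L : PortLabelling) (C : Registers) (p q : Node) : Prop :=
  p ∈ P ∧ q ∈ P ∧ triGrid.Adj p q ∧ MarksOut L C p q ∧ ¬ MarksOut L C q p

/-! ### The rules -/

/-- R1: each edge between `p` and another particle is oriented, and both particles agree on its
direction. -/
def RuleOriented (P : Finset Node) (L : PortLabelling) (C : Registers) (p : Node) : Prop :=
  ∀ q ∈ P, triGrid.Adj p q → DirectedEdge P L C p q ∨ DirectedEdge P L C q p

/-- R2: `p` has at most three outgoing edges. -/
def RuleAtMostThree (P : Finset Node) (L : PortLabelling) (C : Registers) (p : Node) : Prop :=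
  (outPorts P L C p).card ≤ 3

/-- R3: in the cyclic order of the ports of `p`, the outgoing edges are consecutive: they are at
the ports `s, s + 1, …, s + (k - 1)` for some `s` and `k`. -/
def RuleConsecutive (P : Finset Node) (L : PortLabelling) (C : Registers) (p : Node) : Prop :=
  ∃ (s : ZMod 6) (k : ℕ), ∀ i, i ∈ outPorts P L C p ↔ ∃ j : ℕ, j < k ∧ i = s + j

/-- R4: no triangle of particles that contains `p` is a directed cycle. -/
def RuleNoCyclicTriangle (P : Finset Node) (L : PortLabelling) (C : Registers) (p : Node) : Prop :=
  ∀ q r,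
    ¬ (DirectedEdge P L C p q ∧ DirectedEdge P L C q r ∧ DirectedEdge P L C r p)

/-- `p` satisfies R1–R4. -/
def LocallyValid (P : Finset Node) (L : PortLabelling) (C : Registers) (p : Node) : Prop :=
  RuleOriented P L C p ∧ RuleAtMostThree P L C p ∧ RuleConsecutive P L C p ∧
    RuleNoCyclicTriangle P L C p

/-- A valid configuration: every particle satisfies R1–R4. -/
def Valid (P : Finset Node) (L : PortLabelling) (C : Registers) : Prop :=
  ∀ p ∈ P, LocallyValid P L C p

/-- A sink: a particle without outgoing edges. -/
def IsSink (P : Finset Node) (L : PortLabelling) (C : Registers) (p : Node) : Prop :=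
  p ∈ P ∧ outPorts P L C p = ∅

/-- `p` lies on a directed cycle. -/
def OnDirectedCycle (P : Finset Node) (L : PortLabelling) (C : Registers) (p : Node) : Prop :=
  Relation.TransGen (DirectedEdge P L C) p p

/-- The symmetry `φ` of the grid carries what is seen at distance at most one from `p` in the first
configuration (which nodes are occupied, and how the particles there mark their incident edges) to
what is seen at distance at most one from `φ p` in the second one. -/
def SameView (φ : triGrid ≃g triGrid) (P : Finset Node) (L : PortLabelling) (C : Registers)
    (P' : Finset Node) (L' : PortLabelling) (C' : Registers) (p : Node) : Prop :=
  ∀ q, (q = p ∨ triGrid.Adj p q) →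
    (q ∈ P ↔ φ q ∈ P') ∧
      (q ∈ P → ∀ v, triGrid.Adj q v → (MarksOut L C q v ↔ MarksOut L' C' (φ q) (φ v)))

/-! Soundness is an Euler characteristic count. Nodes, edges and small triangles of P form a planar
complex with V - E + F = 1. Charge each edge to its tail and each triangle to the one corner from
which both of its edges leave; that corner exists and is unique because the triangle is not cyclic.
A particle with set A of outgoing directions then contributes `arcWeight A`, which is 1 for a sink
and 0 for an arc of one to three directions. Hence there is exactly one sink
(`SimplyConnected.sum_arcWeight`).

The identity is proved by erosion: deleting a particle whose neighbours form an arc of k ≤ 3 nodes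
removes one node, k edges and k - 1 triangles, and keeps the system simply connected
(`SimplyConnected.erase`). Such particles exist by `SimplyConnected.hasTwoErodible`: the last node
in the row order is erodible, or it is a cut node at which P splits into smaller simply connected
parts. The splitting is a discrete Jordan argument: a closed walk in P crosses a ray from an empty
node an even number of times (`SimplyConnected.unwound`).

Completeness runs the erosion backwards: each edge points from the particle removed earlier to the
one removed later. A hexagon whose rim is a directed cycle around a central sink shows that cycles
can remain. -/

/-! ### Directions -/

/-- The six unit steps, indexed cyclically. -/
def step : ZMod 6 → Node :=
  ![(1, 0), (0, 1), (-1, 1), (-1, 0), (0, -1), (1, -1)]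

theorem mem_gridSteps {d : Node} : d ∈ gridSteps ↔ ∃ i, d = step i := by
  constructor
  · revert d; decide
  · rintro ⟨i, rfl⟩; revert i; decide

theorem step_injective : Function.Injective step := by
  unfold Function.Injective; decide

theorem adj_iff_step {p q : Node} : triGrid.Adj p q ↔ ∃ i, q = p + step i := by
  change q - p ∈ gridSteps ↔ _
  simp only [mem_gridSteps, sub_eq_iff_eq_add']

theorem adj_add_step (p : Node) (i : ZMod 6) : triGrid.Adj p (p + step i) :=
  adj_iff_step.2 ⟨i, rfl⟩

theorem adj_iff_coords {p q : Node} : triGrid.Adj p q ↔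
    (q.1 = p.1 + 1 ∧ q.2 = p.2) ∨ (q.1 = p.1 ∧ q.2 = p.2 + 1) ∨
    (q.1 = p.1 - 1 ∧ q.2 = p.2 + 1) ∨ (q.1 = p.1 - 1 ∧ q.2 = p.2) ∨
    (q.1 = p.1 ∧ q.2 = p.2 - 1) ∨ (q.1 = p.1 + 1 ∧ q.2 = p.2 - 1) := by
  change q - p ∈ gridSteps ↔ _
  simp only [gridSteps, Finset.mem_insert, Finset.mem_singleton, Prod.ext_iff, Prod.fst_sub,
    Prod.snd_sub]
  omega

theorem step_add_step_add_two (i : ZMod 6) : step i + step (i + 2) = step (i + 1) := by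
  revert i; decide

theorem step_add_step_add_four (i : ZMod 6) : step i + step (i + 4) = step (i - 1) := by
  revert i; decide

theorem step_add_step_add_three (i : ZMod 6) : step i + step (i + 3) = 0 := by
  revert i; decide

theorem adj_steps_iff (p : Node) (i j : ZMod 6) :
    triGrid.Adj (p + step i) (p + step j) ↔ j = i + 1 ∨ j = i - 1 := by
  change p + step j - (p + step i) ∈ gridSteps ↔ _
  rw [add_sub_add_left_eq_sub]
  revert i j; decide

/-! ### Connectivity -/

/-- There is a path from `u` to `v` that stays in `S`. -/
def JoinedWithin (S : Set Node) : Node → Node → Prop :=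
  Relation.ReflTransGen fun a b => triGrid.Adj a b ∧ a ∈ S ∧ b ∈ S

theorem JoinedWithin.symm {S : Set Node} {u v : Node} (h : JoinedWithin S u v) : JoinedWithin S v u := by
  induction h with
  | refl => exact Relation.ReflTransGen.refl
  | tail _ hbc ih => exact Relation.ReflTransGen.head ⟨hbc.1.symm, hbc.2.2, hbc.2.1⟩ ih

theorem JoinedWithin.trans {S : Set Node} {u v w : Node} (h : JoinedWithin S u v) (h' : JoinedWithin S v w) :
    JoinedWithin S u w :=
  Relation.ReflTransGen.trans h h'

theorem JoinedWithin.refl (S : Set Node) (u : Node) : JoinedWithin S u u :=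
  Relation.ReflTransGen.refl

theorem JoinedWithin.of_adj {S : Set Node} {u v : Node} (h : triGrid.Adj u v) (hu : u ∈ S)
    (hv : v ∈ S) : JoinedWithin S u v :=
  Relation.ReflTransGen.single ⟨h, hu, hv⟩

theorem JoinedWithin.mono {S T : Set Node} (hST : S ⊆ T) {u v : Node} (h : JoinedWithin S u v) :
    JoinedWithin T u v :=
  Relation.ReflTransGen.mono (fun _ _ h => ⟨h.1, hST h.2.1, hST h.2.2⟩) _ _ h

theorem induce_connected_iff {S : Set Node} :
    (triGrid.induce S).Connected ↔ S.Nonempty ∧ ∀ u ∈ S, ∀ v ∈ S, JoinedWithin S u v := by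
  rw [SimpleGraph.connected_iff, and_comm, Set.nonempty_coe_sort]
  refine and_congr_right fun _ => ⟨fun h u hu v hv => ?_, fun h => ?_⟩
  · have h' := h ⟨u, hu⟩ ⟨v, hv⟩
    rw [SimpleGraph.reachable_iff_reflTransGen] at h'
    exact h'.lift (p := fun a b => triGrid.Adj a b ∧ a ∈ S ∧ b ∈ S) Subtype.val
      fun a b hab => ⟨hab, a.2, b.2⟩
  · have key : ∀ u v, JoinedWithin S u v → ∀ hu : u ∈ S, ∃ hv : v ∈ S,
        (triGrid.induce S).Reachable ⟨u, hu⟩ ⟨v, hv⟩ := by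
      intro u v huv hu
      induction huv with
      | refl => exact ⟨hu, SimpleGraph.Reachable.refl _⟩
      | tail _ hbc ih =>
        obtain ⟨hb, hr⟩ := ih
        refine ⟨hbc.2.2, hr.trans (SimpleGraph.Adj.reachable ?_)⟩
        exact hbc.1
    intro u v
    exact (key u v (h u u.2 v v.2) u.2).2

theorem simplyConnected_iff {P : Finset Node} : SimplyConnected P ↔
    (P.Nonempty ∧ ∀ u ∈ P, ∀ v ∈ P, JoinedWithin (P : Set Node) u v) ∧
      ∀ u ∉ P, ∀ v ∉ P, JoinedWithin (P : Set Node)ᶜ u v := by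
  unfold SimplyConnected
  rw [induce_connected_iff, induce_connected_iff]
  have : ((P : Set Node)ᶜ).Nonempty := P.finite_toSet.infinite_compl.nonempty
  simp [this]

/-- Deleting a node does not disconnect a set if its neighbours in the set stay joined. -/
theorem joined_diff_singleton {S : Set Node} {p u v : Node} (h : JoinedWithin S u v)
    (hnbr : ∀ a ∈ S, ∀ b ∈ S, triGrid.Adj p a → triGrid.Adj p b → JoinedWithin (S \ {p}) a b)
    (hu : u ≠ p) (hv : v ≠ p) : JoinedWithin (S \ {p}) u v := by
  -- A path may pass through `p`. While it sits there, the induction keeps track of all neighbours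
  -- of `p` in `S`, any of which may be the next node.
  suffices H : (v ≠ p → JoinedWithin (S \ {p}) u v) ∧
      (v = p → ∀ b ∈ S, triGrid.Adj p b → JoinedWithin (S \ {p}) u b) from H.1 hv
  clear hv
  induction h with
  | refl => exact ⟨fun _ => JoinedWithin.refl _ _, fun h => absurd h hu⟩
  | @tail x y _ hxy ih =>
    obtain ⟨hadj, hx, hy⟩ := hxy
    by_cases hxp : x = p
    · subst hxp
      exact ⟨fun _ => ih.2 rfl y hy hadj, fun h => absurd h.symm hadj.ne⟩
    · have hux := ih.1 hxp
      refine ⟨fun hyp => hux.trans (JoinedWithin.of_adj hadj ⟨hx, hxp⟩ ⟨hy, hyp⟩), ?_⟩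
      rintro rfl b hb hpb
      exact hux.trans (hnbr x hx b hb hadj.symm hpb)

/-! ### Erodible particles -/

/-- The directions in which `p` has a neighbour in `P`. -/
def ring (P : Finset Node) (p : Node) : Finset (ZMod 6) :=
  {i | p + step i ∈ P}

theorem mem_ring {P : Finset Node} {p : Node} {i : ZMod 6} : i ∈ ring P p ↔ p + step i ∈ P := by
  simp [ring]

/-- One, two or three cyclically consecutive directions. -/
def ShortArc (A : Finset (ZMod 6)) : Prop :=
  ∃ s, A = {s} ∨ A = {s, s + 1} ∨ A = {s, s + 1, s + 2}

instance : DecidablePred ShortArc := fun A => by unfold ShortArc; infer_instance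

/-- The neighbours of `p` in `P` are one, two or three consecutive ones. -/
def Erodible (P : Finset Node) (p : Node) : Prop :=
  p ∈ P ∧ ShortArc (ring P p)

theorem Erodible.exists_notMem {P : Finset Node} {p : Node} (h : Erodible P p) :
    ∃ i, p + step i ∉ P := by
  have key : ∀ A, ShortArc A → ∃ i, i ∉ A := by
    rintro A ⟨s, rfl | rfl | rfl⟩ <;> revert s <;> decide
  obtain ⟨i, hi⟩ := key _ h.2
  exact ⟨i, fun h => hi (mem_ring.2 h)⟩

theorem Erodible.exists_mem {P : Finset Node} {p : Node} (h : Erodible P p) :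
    ∃ i, p + step i ∈ P := by
  obtain ⟨s, h | h | h⟩ := h.2 <;> exact ⟨s, mem_ring.1 (by simp [h])⟩

theorem add_step_ne (p : Node) (i : ZMod 6) : p + step i ≠ p :=
  (adj_add_step p i).ne'

theorem Erodible.nbrs_joined {P : Finset Node} {p a b : Node} (h : Erodible P p) (ha : a ∈ P)
    (hb : b ∈ P) (hpa : triGrid.Adj p a) (hpb : triGrid.Adj p b) :
    JoinedWithin ((P : Set Node) \ {p}) a b := by
  obtain ⟨i, rfl⟩ := adj_iff_step.1 hpa
  obtain ⟨j, rfl⟩ := adj_iff_step.1 hpb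
  have hmem : ∀ k, k ∈ ring P p → p + step k ∈ (P : Set Node) \ {p} := fun k hk =>
    ⟨mem_ring.1 hk, add_step_ne p k⟩
  rw [← mem_ring] at ha hb
  have hlink : ∀ k, k ∈ ring P p → k + 1 ∈ ring P p →
      JoinedWithin ((P : Set Node) \ {p}) (p + step k) (p + step (k + 1)) := fun k hk hk' =>
    JoinedWithin.of_adj ((adj_steps_iff p _ _).2 (Or.inl rfl)) (hmem _ hk) (hmem _ hk')
  have hstart : ∀ s, (ring P p = {s} ∨ ring P p = {s, s + 1} ∨ ring P p = {s, s + 1, s + 2}) →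
      ∀ k ∈ ring P p, JoinedWithin ((P : Set Node) \ {p}) (p + step s) (p + step k) := by
    intro s hs k hk
    have h2 : s + 2 = s + 1 + 1 := by ring
    rcases hs with hs | hs | hs
    · obtain rfl : k = s := by simpa [hs] using hk
      exact JoinedWithin.refl _ _
    · have hk' : k = s ∨ k = s + 1 := by simpa [hs] using hk
      rcases hk' with rfl | rfl
      · exact JoinedWithin.refl _ _
      · exact hlink _ (by simp [hs]) hk
    · have hk' : k = s ∨ k = s + 1 ∨ k = s + 2 := by simpa [hs] using hk
      have h01 := hlink s (by simp [hs]) (by simp [hs])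
      rcases hk' with rfl | rfl | rfl
      · exact JoinedWithin.refl _ _
      · exact h01
      · refine h01.trans ?_
        rw [h2] at hk ⊢
        exact hlink _ (by simp [hs]) hk
  obtain ⟨s, hs⟩ := h.2
  exact (hstart s hs i ha).symm.trans (hstart s hs j hb)

/-- A path through `p` can be rerouted along the arc of its neighbours, and `p` itself joins the
complement through an empty neighbour. -/
theorem SimplyConnected.erase {P : Finset Node} {p : Node} (hP : SimplyConnected P)
    (hp : Erodible P p) : SimplyConnected (P.erase p) := by
  rw [simplyConnected_iff] at hP ⊢
  obtain ⟨⟨_, hconn⟩, hcompl⟩ := hP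
  obtain ⟨i, hi⟩ := hp.exists_mem
  obtain ⟨j, hj⟩ := hp.exists_notMem
  refine ⟨⟨⟨p + step i, ?_⟩, ?_⟩, ?_⟩
  · exact Finset.mem_erase.2 ⟨add_step_ne p i, hi⟩
  · intro u hu v hv
    rw [Finset.mem_erase] at hu hv
    rw [Finset.coe_erase]
    exact joined_diff_singleton (hconn u hu.2 v hv.2)
      (fun a ha b hb => hp.nbrs_joined ha hb) hu.1 hv.1
  · have hsub : (P : Set Node)ᶜ ⊆ ((P.erase p : Finset Node) : Set Node)ᶜ := by
      intro x hx; simp only [Set.mem_compl_iff, Finset.mem_coe, Finset.mem_erase] at hx ⊢; tauto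
    have hto : ∀ u ∉ P.erase p, JoinedWithin ((P.erase p : Finset Node) : Set Node)ᶜ u (p + step j) := by
      intro u hu
      by_cases hup : u = p
      · subst hup
        exact JoinedWithin.of_adj (adj_add_step u j) hu (hsub hj)
      · exact (hcompl u (fun h => hu (Finset.mem_erase.2 ⟨hup, h⟩)) _ hj).mono hsub
    exact fun u hu v hv => (hto u hu).trans (hto v hv).symm

/-! ### Separation -/

/-- The edge `uv` crosses the horizontal ray that starts just above the right of `e`. -/
def Crosses (e u v : Node) : Prop :=
  (u.2 = e.2 ∧ e.1 < u.1 ∧ v.2 = e.2 + 1) ∨ (v.2 = e.2 ∧ e.1 < v.1 ∧ u.2 = e.2 + 1)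

/-- The crossing cocycle of `e` is a coboundary on `P`: no closed walk in `P` winds around `e` an
odd number of times. -/
def Unwound (P : Finset Node) (e : Node) : Prop :=
  ∃ f : Node → Prop, ∀ u ∈ P, ∀ v ∈ P, triGrid.Adj u v → (Crosses e u v ↔ ¬ (f u ↔ f v))

/-- Modulo 2, cocycles that differ by the coboundary of `g` are cohomologous; a potential for one
becomes a potential for the other by adding `g`. -/
theorem unwound_iff_of_coboundary {P : Finset Node} {e e' : Node} (g : Node → Prop)
    (h : ∀ u ∈ P, ∀ v ∈ P, triGrid.Adj u v →
      (¬ (Crosses e u v ↔ Crosses e' u v) ↔ ¬ (g u ↔ g v))) :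
    Unwound P e ↔ Unwound P e' := by
  constructor <;> rintro ⟨f, hf⟩ <;> refine ⟨fun u => ¬ (f u ↔ g u), fun u hu v hv huv => ?_⟩ <;>
    · have h1 := hf u hu v hv huv
      have h2 := h u hu v hv huv
      by_cases f u <;> by_cases f v <;> by_cases g u <;> by_cases g v <;> simp_all

theorem unwound_iff_of_adj {P : Finset Node} {e e' : Node} (hadj : triGrid.Adj e e')
    (he : e ∉ P) (he' : e' ∉ P) : Unwound P e ↔ Unwound P e' := by
  wlog hdir : (e'.1 = e.1 + 1 ∧ e'.2 = e.2) ∨ (e'.1 = e.1 ∧ e'.2 = e.2 + 1) ∨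
      (e'.1 = e.1 - 1 ∧ e'.2 = e.2 + 1) generalizing e e'
  · refine (this hadj.symm he' he ?_).symm
    rw [adj_iff_coords] at hadj
    omega
  have hne : ∀ u ∈ P, ¬ (u.1 = e.1 ∧ u.2 = e.2) ∧ ¬ (u.1 = e'.1 ∧ u.2 = e'.2) := fun u hu =>
    ⟨fun h => he (Prod.ext h.1 h.2 ▸ hu), fun h => he' (Prod.ext h.1 h.2 ▸ hu)⟩
  -- Within a row the two rays meet the same edges of `P`, since `e'` is empty, and the potential
  -- vanishes. Between rows, the two rays bound the part of the row of `e'` to the right of `e'`; an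
  -- edge of `P` leaves this half-row exactly when it crosses one of the rays, because `e` and `e'`
  -- are empty.
  refine unwound_iff_of_coboundary (fun u => e'.2 = e.2 + 1 ∧ u.2 = e'.2 ∧ e'.1 < u.1) ?_
  intro u hu v hv huv
  have h1 := hne u hu
  have h2 := hne v hv
  rw [adj_iff_coords] at huv
  unfold Crosses
  clear hne hadj hu hv he he'
  rcases hdir with h | h | h <;> rcases huv with h' | h' | h' | h' | h' | h' <;> omega

/-- No edge of `P` crosses the ray of a node above `P`, and the property is carried to `e` along a
path in the complement. -/
theorem SimplyConnected.unwound {P : Finset Node} (hP : SimplyConnected P) {e : Node}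
    (he : e ∉ P) (htop : ∃ e₀ : Node, ∀ u ∈ P, u.2 < e₀.2) : Unwound P e := by
  obtain ⟨e₀, h₀⟩ := htop
  have he₀ : e₀ ∉ P := fun h => lt_irrefl _ (h₀ _ h)
  have hU : Unwound P e₀ := by
    refine ⟨fun _ => True, fun u hu v hv _ => ?_⟩
    have := h₀ u hu
    have := h₀ v hv
    unfold Crosses
    simp only [not_true, iff_false]
    omega
  have hj := (simplyConnected_iff.1 hP).2 e₀ he₀ e he
  induction hj with
  | refl => exact hU
  | tail _ hbc ih =>
    exact (unwound_iff_of_adj hbc.1 hbc.2.1 hbc.2.2).1 (ih hbc.2.1)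

/-! ### Existence of erodible particles -/

/-- `p` is the last node of `P` in the order by rows from bottom to top, and from left to right
inside a row. -/
def IsTopRight (P : Finset Node) (p : Node) : Prop :=
  p ∈ P ∧ ∀ v ∈ P, v.2 < p.2 ∨ (v.2 = p.2 ∧ v.1 ≤ p.1)

theorem exists_isTopRight {P : Finset Node} (hP : P.Nonempty) : ∃ p, IsTopRight P p := by
  obtain ⟨p, hp, hmax⟩ := P.exists_max_image (fun v => toLex (v.2, v.1)) hP
  refine ⟨p, hp, fun v hv => ?_⟩
  have := hmax v hv
  rw [Prod.Lex.toLex_le_toLex] at this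
  exact this

/-- A union of components of `P` minus a topmost node `p`, together with `p`, is simply
connected. -/
theorem SimplyConnected.insert_of_closed {P S : Finset Node} {p : Node} (hP : SimplyConnected P)
    (hp : p ∈ P) (htop : ∀ v ∈ P, v.2 ≤ p.2) (hS : S ⊆ P.erase p)
    (hclosed : ∀ u ∈ P.erase p, ∀ v ∈ P.erase p, triGrid.Adj u v → (u ∈ S ↔ v ∈ S)) :
    SimplyConnected (insert p S) := by
  rw [simplyConnected_iff] at hP ⊢
  obtain ⟨⟨_, hconn⟩, hcompl⟩ := hP
  refine ⟨⟨⟨p, by simp⟩, ?_⟩, ?_⟩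
  · have hto : ∀ u ∈ insert p S, JoinedWithin ((insert p S : Finset Node) : Set Node) p u := by
      suffices H : ∀ u, JoinedWithin (P : Set Node) p u → u ∈ insert p S →
          JoinedWithin ((insert p S : Finset Node) : Set Node) p u by
        intro u hu
        refine H u (hconn p hp u ?_) hu
        rcases Finset.mem_insert.1 hu with rfl | h
        · exact hp
        · exact (Finset.mem_erase.1 (hS h)).2
      intro u hu
      induction hu with
      | refl => exact fun _ => JoinedWithin.refl _ _
      | @tail b c _ hbc ih =>
        intro hc
        have hb : b ∈ insert p S ∨ c = p := by
          by_cases hbp : b = p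
          · simp [hbp]
          by_cases hcp : c = p
          · exact Or.inr hcp
          refine Or.inl (Finset.mem_insert_of_mem ?_)
          refine (hclosed b (Finset.mem_erase.2 ⟨hbp, hbc.2.1⟩) c
            (Finset.mem_erase.2 ⟨hcp, hbc.2.2⟩) hbc.1).2 ?_
          exact (Finset.mem_insert.1 hc).resolve_left hcp
        rcases hb with hb | rfl
        · exact (ih hb).trans (JoinedWithin.of_adj hbc.1 hb hc)
        · exact JoinedWithin.refl _ _
    exact fun u hu v hv => (hto u hu).symm.trans (hto v hv)
  · have hsub : (P : Set Node)ᶜ ⊆ ((insert p S : Finset Node) : Set Node)ᶜ := by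
      intro x hx hx'
      rcases Finset.mem_insert.1 hx' with rfl | h
      · exact hx hp
      · exact hx (Finset.mem_erase.1 (hS h)).2
    obtain ⟨m, hm⟩ : ∃ m : ℤ, ∀ v ∈ P, m < v.2 := by
      obtain ⟨q, _, hq⟩ := P.exists_min_image (fun v => v.2) ⟨p, hp⟩
      exact ⟨q.2 - 1, fun v hv => by have := hq v hv; omega⟩
    -- A node of `P` outside the part escapes by walking straight down: it cannot enter `S`, which
    -- is closed under adjacency away from `p`, nor hit `p`, which lies in the top row. Below row
    -- `m` there is nothing of `P`.
    have hto : ∀ n : ℕ, ∀ u : Node, u ∉ insert p S → u.2 ≤ m + n →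
        ∃ w ∉ P, JoinedWithin ((insert p S : Finset Node) : Set Node)ᶜ u w := by
      intro n
      induction n with
      | zero =>
        intro u _ hum
        exact ⟨u, fun h => by have := hm u h; simp at hum; omega, JoinedWithin.refl _ _⟩
      | succ n ih =>
        intro u hu hum
        by_cases huP : u ∈ P
        · have hup : u ≠ p := fun h => hu (by simp [h])
          have hadj := adj_add_step u 4
          have hlow : (u + step 4).2 = u.2 - 1 := rfl
          have hdown : u + step 4 ∉ insert p S := by
            intro h
            rcases Finset.mem_insert.1 h with h | h
            · have := htop u huP
              rw [← h, hlow] at this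
              omega
            · exact hu (Finset.mem_insert_of_mem
                ((hclosed u (Finset.mem_erase.2 ⟨hup, huP⟩) _ (hS h) hadj).2 h))
          obtain ⟨w, hw, hj⟩ := ih _ hdown (by rw [hlow]; push_cast at hum; omega)
          exact ⟨w, hw, (JoinedWithin.of_adj hadj hu hdown).trans hj⟩
        · exact ⟨u, huP, JoinedWithin.refl _ _⟩
    intro u hu v hv
    obtain ⟨w, hw, huw⟩ := hto (u.2 - m).toNat u hu (by have := Int.self_le_toNat (u.2 - m); omega)
    obtain ⟨z, hz, hvz⟩ := hto (v.2 - m).toNat v hv (by have := Int.self_le_toNat (v.2 - m); omega)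
    exact huw.trans (((hcompl w hw z hz).mono hsub).trans hvz.symm)

/-- A top right node that is not erodible has exactly two neighbours, in the directions `3`
and `5`. -/
theorem ring_eq_of_isTopRight {P : Finset Node} {p : Node} (hP : SimplyConnected P)
    (hcard : 2 ≤ P.card) (hp : IsTopRight P p) (hne : ¬ Erodible P p) : ring P p = {3, 5} := by
  have hsub : ring P p ⊆ {3, 4, 5} := by
    intro i hi
    have h := hp.2 _ (mem_ring.1 hi)
    rw [Prod.snd_add, Prod.fst_add] at h
    have key : ∀ i : ZMod 6, i ∈ ({3, 4, 5} : Finset (ZMod 6)) ∨ 0 < (step i).2 ∨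
        ((step i).2 = 0 ∧ 0 < (step i).1) := by decide
    rcases key i with h' | h' | h'
    · exact h'
    · omega
    · omega
  have hnonempty : (ring P p).Nonempty := by
    obtain ⟨q, hq, hqp⟩ := Finset.exists_mem_ne (by omega : 1 < P.card) p
    have hj := ((simplyConnected_iff.1 hP).1.2 p hp.1 q hq)
    rcases Relation.ReflTransGen.cases_head hj with h | ⟨c, hc, _⟩
    · exact absurd h.symm hqp
    · obtain ⟨i, rfl⟩ := adj_iff_step.1 hc.1
      exact ⟨i, mem_ring.2 hc.2.2⟩
  have hnot : ¬ ShortArc (ring P p) := fun h => hne ⟨hp.1, h⟩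
  have key : ∀ A ∈ ({3, 4, 5} : Finset (ZMod 6)).powerset, A.Nonempty → ¬ ShortArc A →
      A = {3, 5} := by decide
  exact key _ (Finset.mem_powerset.2 hsub) hnonempty hnot

/-- If a top right node is not erodible, then `P` splits there into two simply connected parts. -/
theorem exists_split {P : Finset Node} {p : Node} (hP : SimplyConnected P)
    (hp : IsTopRight P p) (hring : ring P p = {3, 5}) :
    ∃ S ⊆ P.erase p, S.Nonempty ∧ (P.erase p \ S).Nonempty ∧
      ∀ u ∈ P.erase p, ∀ v ∈ P.erase p, triGrid.Adj u v → (u ∈ S ↔ v ∈ S) := by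
  classical
  have hW : p + step 3 ∈ P := mem_ring.1 (by rw [hring]; decide)
  have hSE : p + step 5 ∈ P := mem_ring.1 (by rw [hring]; decide)
  have hSW : p + step 4 ∉ P := fun h => by
    have := mem_ring.2 h
    rw [hring] at this
    revert this; decide
  obtain ⟨f, hf⟩ := hP.unwound hSW ⟨p + step 1, fun u hu => by
    have := hp.2 u hu
    change u.2 < p.2 + 1
    omega⟩
  -- The top row of `P` ends at `p`, so the ray from the empty node in direction 4 meets only the
  -- edge from `p` to its neighbour in direction 5. The potential `f` therefore changes on that edge
  -- alone, and its level sets on `P` minus `p` separate the two neighbours of `p`.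
  have hcross : ∀ u ∈ P, ∀ v ∈ P, triGrid.Adj u v →
      (Crosses (p + step 4) u v ↔ (u = p ∧ v = p + step 5) ∨ (v = p ∧ u = p + step 5)) := by
    intro u hu v hv huv
    have h1 := hp.2 u hu
    have h2 := hp.2 v hv
    rw [adj_iff_coords] at huv
    have e4 : step 4 = (0, -1) := rfl
    have e5 : step 5 = (1, -1) := rfl
    simp only [Crosses, e4, e5, Prod.ext_iff, Prod.fst_add, Prod.snd_add]
    rcases huv with h' | h' | h' | h' | h' | h' <;> omega
  refine ⟨(P.erase p).filter (fun u => f u ↔ f p), Finset.filter_subset _ _,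
    ⟨p + step 3, ?_⟩, ⟨p + step 5, ?_⟩, ?_⟩
  · refine Finset.mem_filter.2 ⟨Finset.mem_erase.2 ⟨add_step_ne _ _, hW⟩, ?_⟩
    have h := hf p hp.1 _ hW (adj_add_step p 3)
    rw [hcross p hp.1 _ hW (adj_add_step p 3)] at h
    have h35 : step 3 ≠ step 5 := by decide
    have h3 : p + step 3 ≠ p := add_step_ne p 3
    simp only [add_right_inj, h35, h3, and_false, false_and, or_self, false_iff, not_not] at h
    exact h.symm
  · have h := hf p hp.1 _ hSE (adj_add_step p 5)
    rw [hcross p hp.1 _ hSE (adj_add_step p 5)] at h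
    simp only [and_self, true_or, true_iff] at h
    simp only [Finset.mem_sdiff, Finset.mem_filter, Finset.mem_erase]
    refine ⟨⟨add_step_ne _ _, hSE⟩, fun h' => h h'.2.symm⟩
  · intro u hu v hv huv
    have h := hf u (Finset.mem_erase.1 hu).2 v (Finset.mem_erase.1 hv).2 huv
    rw [hcross u (Finset.mem_erase.1 hu).2 v (Finset.mem_erase.1 hv).2 huv] at h
    have hu' := (Finset.mem_erase.1 hu).1
    have hv' := (Finset.mem_erase.1 hv).1
    simp only [hu', hv', false_and, or_self, false_iff, not_not] at h
    simp only [Finset.mem_filter, hu, hv, true_and, h]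

/-- Erodibility in a part that is cut off at `p` is erodibility in `P`. -/
theorem Erodible.of_insert {P S : Finset Node} {p a : Node} (hp : p ∈ P) (hS : S ⊆ P.erase p)
    (hclosed : ∀ u ∈ P.erase p, ∀ v ∈ P.erase p, triGrid.Adj u v → (u ∈ S ↔ v ∈ S))
    (ha : Erodible (insert p S) a) (hap : a ≠ p) : a ∈ S ∧ Erodible P a := by
  have haS : a ∈ S := (Finset.mem_insert.1 ha.1).resolve_left hap
  refine ⟨haS, (Finset.mem_erase.1 (hS haS)).2, ?_⟩
  convert ha.2 using 1
  ext i
  rw [mem_ring, mem_ring, Finset.mem_insert]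
  by_cases hip : a + step i = p
  · simp [hip, hp]
  · simp only [hip, false_or]
    constructor
    · intro h
      exact (hclosed a (hS haS) _ (Finset.mem_erase.2 ⟨hip, h⟩) (adj_add_step a i)).1 haS
    · exact fun h => (Finset.mem_erase.1 (hS h)).2

/-- `P` has an erodible particle different from any given node. -/
def HasTwoErodible (P : Finset Node) : Prop :=
  ∀ x, ∃ a, a ≠ x ∧ Erodible P a

/-- If `p` is a cut node, each of the two parts together with `p` is smaller and has an erodible
particle other than `p`. This is why the induction needs an erodible particle avoiding a given node:
one at `p` would be useless in `P`. -/
theorem erodible_topRight_or_hasTwoErodible {P : Finset Node} {p : Node} (hP : SimplyConnected P)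
    (hcard : 2 ≤ P.card) (hp : IsTopRight P p)
    (ih : ∀ Q : Finset Node, SimplyConnected Q → 2 ≤ Q.card → Q.card < P.card →
      HasTwoErodible Q) :
    Erodible P p ∨ HasTwoErodible P := by
  by_contra! hcon
  obtain ⟨hne, hcon⟩ := hcon
  apply hcon
  obtain ⟨S, hS, hSne, hTne, hclosed⟩ :=
    exists_split hP hp (ring_eq_of_isTopRight hP hcard hp hne)
  have hpart : ∀ S ⊆ P.erase p, S.Nonempty → (P.erase p \ S).Nonempty →
      (∀ u ∈ P.erase p, ∀ v ∈ P.erase p, triGrid.Adj u v → (u ∈ S ↔ v ∈ S)) →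
      ∃ a ∈ S, Erodible P a := by
    intro S hS hSne hTne hclosed
    have hpS : p ∉ S := fun h => (Finset.mem_erase.1 (hS h)).1 rfl
    have hSC := hP.insert_of_closed hp.1
      (fun v hv => by have := hp.2 v hv; omega) hS hclosed
    have hc1 : (insert p S).card = S.card + 1 := Finset.card_insert_of_notMem hpS
    have hc2 := Finset.card_erase_of_mem hp.1
    have hc3 := Finset.card_sdiff_add_card_eq_card hS
    have hc4 := hSne.card_pos
    have hc5 := hTne.card_pos
    obtain ⟨a, hap, ha⟩ := ih _ hSC (by omega) (by omega) p
    exact ⟨a, ha.of_insert hp.1 hS hclosed hap⟩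
  intro x
  by_cases hx : x ∈ S
  · obtain ⟨a, haT, ha⟩ := hpart (P.erase p \ S) Finset.sdiff_subset hTne
      (by rwa [Finset.sdiff_sdiff_eq_self hS])
      (fun u hu v hv huv => by
        simp only [Finset.mem_sdiff, hu, hv, true_and, hclosed u hu v hv huv])
    exact ⟨a, fun h => (Finset.mem_sdiff.1 haT).2 (h ▸ hx), ha⟩
  · obtain ⟨a, haS, ha⟩ := hpart S hS hSne hTne hclosed
    exact ⟨a, fun h => hx (h ▸ haS), ha⟩

/-- The image of `P` under the point reflection at the origin. -/
def reflect (P : Finset Node) : Finset Node :=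
  P.map (Equiv.neg Node).toEmbedding

theorem mem_reflect {P : Finset Node} {v : Node} : v ∈ reflect P ↔ -v ∈ P := by
  simp [reflect, Finset.mem_map_equiv]

theorem card_reflect (P : Finset Node) : (reflect P).card = P.card :=
  Finset.card_map _

theorem reflect_reflect (P : Finset Node) : reflect (reflect P) = P := by
  ext v; simp [mem_reflect]

theorem JoinedWithin.neg {S T : Set Node} (hST : ∀ v ∈ S, -v ∈ T) {u v : Node}
    (h : JoinedWithin S u v) : JoinedWithin T (-u) (-v) := by
  refine Relation.ReflTransGen.lift (p := fun a b => triGrid.Adj a b ∧ a ∈ T ∧ b ∈ T)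
    (fun v : Node => -v) (fun a b hab => ⟨?_, hST a hab.2.1, hST b hab.2.2⟩) _ _ h
  have h := hab.1.symm
  rw [adj_iff_coords] at h ⊢
  simp only [Prod.fst_neg, Prod.snd_neg]
  omega

theorem SimplyConnected.reflect {P : Finset Node} (hP : SimplyConnected P) :
    SimplyConnected (reflect P) := by
  rw [simplyConnected_iff] at hP ⊢
  obtain ⟨⟨⟨p, hp⟩, hconn⟩, hcompl⟩ := hP
  refine ⟨⟨⟨-p, by rwa [mem_reflect, neg_neg]⟩, fun u hu v hv => ?_⟩, fun u hu v hv => ?_⟩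
  · rw [mem_reflect] at hu hv
    have := (hconn _ hu _ hv).neg (T := (_root_.reflect P : Finset Node))
      (fun v hv => by simpa [mem_reflect] using hv)
    simpa using this
  · rw [mem_reflect] at hu hv
    have := (hcompl _ hu _ hv).neg (T := ((_root_.reflect P : Finset Node) : Set Node)ᶜ)
      (fun v hv => by simpa [mem_reflect] using hv)
    simpa using this

theorem Erodible.reflect {P : Finset Node} {a : Node} (h : Erodible P a) :
    Erodible (reflect P) (-a) := by
  refine ⟨by simpa [mem_reflect] using h.1, ?_⟩
  have hring : ring (_root_.reflect P) (-a) = (ring P a).image (· + 3) := by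
    ext i
    have h3 : step (i - 3) = -step i := by revert i; decide
    rw [mem_ring, mem_reflect, Finset.mem_image]
    have : -(-a + step i) = a + step (i - 3) := by rw [h3]; abel
    rw [this, ← mem_ring]
    constructor
    · exact fun h => ⟨_, h, by ring⟩
    · rintro ⟨j, hj, rfl⟩
      simpa using hj
  rw [hring]
  obtain ⟨s, h | h | h⟩ := h.2 <;> rw [h] <;> clear * - <;> revert s <;> decide

theorem HasTwoErodible.reflect {P : Finset Node} (h : HasTwoErodible P) :
    HasTwoErodible (reflect P) := by
  intro x
  obtain ⟨a, hax, ha⟩ := h (-x)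
  exact ⟨-a, fun h => hax (by rw [← h, neg_neg]), ha.reflect⟩

/-- The first and the last node in the row order serve as the two erodible particles, the first one
being handled by reflection, unless one of them is a cut node. -/
theorem SimplyConnected.hasTwoErodible {P : Finset Node} (hP : SimplyConnected P)
    (hcard : 2 ≤ P.card) : HasTwoErodible P := by
  induction hn : P.card using Nat.strong_induction_on generalizing P with
  | _ n ih =>
    subst hn
    have ih' : ∀ Q : Finset Node, SimplyConnected Q → 2 ≤ Q.card → Q.card < P.card →
      HasTwoErodible Q := fun Q hQ h2 hlt => ih _ hlt hQ h2 rfl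
    have hne : P.Nonempty := Finset.card_pos.1 (by omega)
    obtain ⟨p, hp⟩ := exists_isTopRight hne
    obtain ⟨q, hq⟩ := exists_isTopRight (P := _root_.reflect P)
      (Finset.card_pos.1 (by rw [card_reflect]; omega))
    rcases erodible_topRight_or_hasTwoErodible hP hcard hp ih' with hpe | h
    swap
    · exact h
    rcases erodible_topRight_or_hasTwoErodible hP.reflect (by rwa [card_reflect]) hq
      (by rwa [card_reflect]) with hqe | h
    swap
    · exact reflect_reflect P ▸ h.reflect
    have hqe' : Erodible P (-q) := reflect_reflect P ▸ hqe.reflect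
    have hpq : p ≠ -q := by
      rintro rfl
      obtain ⟨v, hv, hvp⟩ := Finset.exists_mem_ne (by omega : 1 < P.card) (-q)
      have h1 := hp.2 v hv
      have h2 := hq.2 (-v) (by simpa [mem_reflect] using hv)
      simp only [Prod.fst_neg, Prod.snd_neg] at h1 h2
      exact hvp (Prod.ext (by simp only [Prod.fst_neg]; omega) (by simp only [Prod.snd_neg]; omega))
    intro x
    by_cases hx : p = x
    · exact ⟨-q, fun h => hpq (hx.trans h.symm), hqe'⟩
    · exact ⟨p, hx, hpe⟩

/-- Every simply connected system is eroded to a single particle by removing erodible particles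
one by one. -/
theorem SimplyConnected.erosion_induction {M : Finset Node → Prop} (single : ∀ p, M {p})
    (insert : ∀ P p, Erodible P p → M (P.erase p) → M P) {P : Finset Node}
    (hP : SimplyConnected P) : M P := by
  induction hn : P.card using Nat.strong_induction_on generalizing P with
  | _ n ih =>
    subst hn
    obtain ⟨p, hp⟩ := (simplyConnected_iff.1 hP).1.1
    by_cases hcard : 2 ≤ P.card
    · obtain ⟨a, _, ha⟩ := hP.hasTwoErodible hcard p
      exact insert P a ha (ih _ (Finset.card_erase_lt_of_mem ha.1) (hP.erase ha) rfl)
    · obtain ⟨q, rfl⟩ := Finset.card_eq_one.1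
        (by have := Finset.card_pos.2 ⟨p, hp⟩; omega : P.card = 1)
      exact single q

/-! ### Counting sinks -/

/-- The directions in which `q` points to a node of `P` along the relation `D`. -/
noncomputable def outDirs (P : Finset Node) (D : Node → Node → Prop) (q : Node) :
    Finset (ZMod 6) :=
  open Classical in {i | q + step i ∈ P ∧ D q (q + step i)}

theorem mem_outDirs {P : Finset Node} {D : Node → Node → Prop} {q : Node} {i : ZMod 6} :
    i ∈ outDirs P D q ↔ q + step i ∈ P ∧ D q (q + step i) := by
  simp [outDirs]

/-- The indicator function of `A`. -/
def ind (A : Finset (ZMod 6)) (i : ZMod 6) : ℤ :=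
  if i ∈ A then 1 else 0

/-- One minus the number of elements of `A` plus the number of adjacent pairs in `A`. -/
def arcWeight (A : Finset (ZMod 6)) : ℤ :=
  1 - ∑ i, ind A i + ∑ i, ind A i * ind A (i + 1)

theorem arcWeight_empty : arcWeight ∅ = 1 := by
  decide

theorem ShortArc.arcWeight_eq_zero {A : Finset (ZMod 6)} (h : ShortArc A) : arcWeight A = 0 := by
  obtain ⟨s, rfl | rfl | rfl⟩ := h <;> revert s <;> decide

/-- Deleting `m` loses one element and the pairs that `m` forms with its two cyclic neighbours. -/
theorem arcWeight_sub_arcWeight_erase (A : Finset (ZMod 6)) (m : ZMod 6) :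
    arcWeight A - arcWeight (A.erase m) = ind A m * (ind A (m - 1) + ind A (m + 1) - 1) := by
  have h : ∀ i, ind (A.erase m) i = if i = m then 0 else ind A i := by
    intro i
    unfold ind
    by_cases hi : i = m <;> simp [hi]
  unfold arcWeight
  simp only [h]
  generalize ind A = b
  -- Shifting all indices by `m` puts the deleted element at 0, so that every index comparison is
  -- between numerals.
  rw [← Equiv.sum_comp (Equiv.addLeft m) b, ← Equiv.sum_comp (Equiv.addLeft m) (fun i => b i * _),
    ← Equiv.sum_comp (Equiv.addLeft m) (fun i => if i = m then 0 else b i),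
    ← Equiv.sum_comp (Equiv.addLeft m) (fun i => (if i = m then 0 else b i) * _)]
  simp only [Equiv.coe_addLeft, add_eq_left, add_assoc]
  have hsum : ∀ f : ZMod 6 → ℤ, ∑ i, f i = f 0 + f 1 + f 2 + f 3 + f 4 + f 5 := fun f =>
    Fin.sum_univ_six f
  have h5 : m - 1 = m + 5 := by
    rw [sub_eq_add_neg]; rfl
  have e1 : (0 : ZMod 6) + 1 = 1 := rfl
  have e2 : (1 : ZMod 6) + 1 = 2 := rfl
  have e3 : (2 : ZMod 6) + 1 = 3 := rfl
  have e4 : (3 : ZMod 6) + 1 = 4 := rfl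
  have e5 : (4 : ZMod 6) + 1 = 5 := rfl
  have e6 : (5 : ZMod 6) + 1 = 0 := rfl
  have n1 : (1 : ZMod 6) ≠ 0 := by decide
  have n2 : (2 : ZMod 6) ≠ 0 := by decide
  have n3 : (3 : ZMod 6) ≠ 0 := by decide
  have n4 : (4 : ZMod 6) ≠ 0 := by decide
  have n5 : (5 : ZMod 6) ≠ 0 := by decide
  simp only [hsum, h5, e1, e2, e3, e4, e5, e6, n1, n2, n3, n4, n5, if_true, if_false, add_zero]
  ring

/-- `D` orients every edge between nodes of `P`, and no triangle cyclically. -/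
structure TriangleAcyclic (P : Finset Node) (D : Node → Node → Prop) : Prop where
  oriented : ∀ u ∈ P, ∀ v ∈ P, triGrid.Adj u v → (D u v ↔ ¬ D v u)
  not_cyclic : ∀ u ∈ P, ∀ v ∈ P, ∀ w ∈ P, triGrid.Adj u v → triGrid.Adj v w → triGrid.Adj w u →
    ¬ (D u v ∧ D v w ∧ D w u)

theorem TriangleAcyclic.mono {P Q : Finset Node} {D : Node → Node → Prop}
    (h : TriangleAcyclic P D) (hQ : Q ⊆ P) : TriangleAcyclic Q D :=
  ⟨fun u hu v hv => h.1 u (hQ hu) v (hQ hv),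
    fun u hu v hv w hw => h.2 u (hQ hu) v (hQ hv) w (hQ hw)⟩

theorem outDirs_erase (P : Finset Node) (D : Node → Node → Prop) (p : Node) (i : ZMod 6) :
    outDirs (P.erase p) D (p + step i) = (outDirs P D (p + step i)).erase (i + 3) := by
  ext j
  have : p + step i + step j = p ↔ j = i + 3 := by
    rw [add_assoc, add_eq_left]
    revert i j; decide
  simp only [mem_outDirs, Finset.mem_erase, ne_eq, this, and_assoc]

theorem outDirs_erase_of_not_adj {P : Finset Node} {D : Node → Node → Prop} {p q : Node}
    (h : ¬ triGrid.Adj p q) : outDirs (P.erase p) D q = outDirs P D q := by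
  ext j
  have : q + step j ≠ p := fun hj => h (adj_iff_step.2 ⟨j, hj.symm⟩ |>.symm)
  simp only [mem_outDirs, Finset.mem_erase, ne_eq, this, not_false_eq_true, true_and]

/-- Only neighbours of `p` lose a direction. Seen from `p + step i`, the node `p` lies in direction
`i + 3`, flanked by the neighbours of `p` in directions `i + 1` and `i - 1`. -/
theorem sum_arcWeight_sub (P : Finset Node) (D : Node → Node → Prop) (p : Node) :
    ∑ q ∈ P.erase p, (arcWeight (outDirs P D q) - arcWeight (outDirs (P.erase p) D q)) =
      ∑ i ∈ ring P p, ind (outDirs P D (p + step i)) (i + 3) *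
        (ind (outDirs P D (p + step i)) (i + 2) + ind (outDirs P D (p + step i)) (i + 4) - 1) := by
  have hinj : Function.Injective fun i => p + step i := fun i j h =>
    step_injective (add_left_cancel h)
  rw [← Finset.sum_subset (s₁ := (ring P p).image fun i => p + step i),
    Finset.sum_image fun i _ j _ h => hinj h]
  · refine Finset.sum_congr rfl fun i _ => ?_
    have h2 : i + 3 - 1 = i + 2 := by ring
    have h4 : i + 3 + 1 = i + 4 := by ring
    rw [outDirs_erase, arcWeight_sub_arcWeight_erase, h2, h4]
  · intro q hq
    obtain ⟨i, hi, rfl⟩ := Finset.mem_image.1 hq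
    exact Finset.mem_erase.2 ⟨add_step_ne p i, mem_ring.1 hi⟩
  · intro q hq hq'
    rw [outDirs_erase_of_not_adj, sub_self]
    intro hadj
    obtain ⟨i, rfl⟩ := adj_iff_step.1 hadj
    exact hq' (Finset.mem_image.2 ⟨i, mem_ring.2 (Finset.mem_erase.1 hq).2, rfl⟩)

/-- The contributions of an erodible particle cancel. -/
theorem Erodible.arcWeight_add_sum {P : Finset Node} {D : Node → Node → Prop} {p : Node}
    (hp : Erodible P p) (hD : TriangleAcyclic P D) :
    arcWeight (outDirs P D p) + ∑ i ∈ ring P p, ind (outDirs P D (p + step i)) (i + 3) *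
        (ind (outDirs P D (p + step i)) (i + 2) + ind (outDirs P D (p + step i)) (i + 4) - 1) =
      0 := by
  classical
  obtain ⟨hpP, s, hs⟩ := hp
  set x : ZMod 6 → ℤ := ind (outDirs P D p) with hx
  set y : ZMod 6 → ℤ := fun i => ind (outDirs P D (p + step i)) (i + 3) with hy
  set u : ZMod 6 → ℤ := fun i => ind (outDirs P D (p + step i)) (i + 2) with hu
  set w : ZMod 6 → ℤ := fun i => ind (outDirs P D (p + step i)) (i + 4) with hw
  have a2 : ∀ i, p + step i + step (i + 2) = p + step (i + 1) := fun i => by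
    rw [add_assoc, step_add_step_add_two]
  have a3 : ∀ i, p + step i + step (i + 3) = p := fun i => by
    rw [add_assoc, step_add_step_add_three, add_zero]
  have a4 : ∀ i, p + step i + step (i + 4) = p + step (i - 1) := fun i => by
    rw [add_assoc, step_add_step_add_four]
  have x0 : ∀ i, i ∉ ring P p → x i = 0 := fun i hi => by
    rw [mem_ring] at hi
    simp [hx, ind, mem_outDirs, hi]
  have u0 : ∀ i, i + 1 ∉ ring P p → u i = 0 := fun i hi => by
    rw [mem_ring] at hi
    simp [hu, ind, mem_outDirs, a2, hi]
  have w0 : ∀ i, i - 1 ∉ ring P p → w i = 0 := fun i hi => by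
    rw [mem_ring] at hi
    simp [hw, ind, mem_outDirs, a4, hi]
  have hxy : ∀ i, i ∈ ring P p → y i = 1 - x i := fun i hi => by
    rw [mem_ring] at hi
    have h := hD.oriented p hpP _ hi (adj_add_step p i)
    simp only [hx, hy, ind, mem_outDirs, a3, hi, hpP, true_and]
    by_cases h' : D (p + step i) p <;> simp [h, h']
  -- The three products indicate which corner of the triangle is its source; exactly one of them is
  -- 1.
  have htri : ∀ i, i ∈ ring P p → i + 1 ∈ ring P p →
      x i * x (i + 1) + y i * u i + y (i + 1) * w (i + 1) = 1 := fun i hi hi' => by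
    rw [mem_ring] at hi hi'
    have hadj := (adj_steps_iff p i (i + 1)).2 (Or.inl rfl)
    have h1 := hD.oriented p hpP _ hi (adj_add_step p i)
    have h2 := hD.oriented p hpP _ hi' (adj_add_step p (i + 1))
    have h3 := hD.oriented _ hi _ hi' hadj
    have h4 := hD.not_cyclic p hpP _ hi _ hi' (adj_add_step p i) hadj (adj_add_step p (i + 1)).symm
    have h5 := hD.not_cyclic p hpP _ hi' _ hi (adj_add_step p (i + 1)) hadj.symm
      (adj_add_step p i).symm
    simp only [hx, hy, hu, hw, ind, mem_outDirs, a2, a3, a4, hi, hi', hpP, true_and,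
      add_sub_cancel_right]
    by_cases c1 : D (p + step i) p <;> by_cases c2 : D (p + step (i + 1)) p <;>
      by_cases c3 : D (p + step (i + 1)) (p + step i) <;> simp_all
  have hsum1 : ∑ i, x i = ∑ i ∈ ring P p, x i :=
    (Finset.sum_subset (Finset.subset_univ _) fun i _ hi => x0 i hi).symm
  have hsum2 : ∑ i, x i * x (i + 1) = ∑ i ∈ ring P p, x i * x (i + 1) :=
    (Finset.sum_subset (Finset.subset_univ _) fun i _ hi => by rw [x0 i hi, zero_mul]).symm
  have e2 : s + 1 + 1 = s + 2 := by ring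
  have e3 : s + 2 + 1 = s + 3 := by ring
  have n1 : s ≠ s + 1 := by clear * -; revert s; decide
  have n2 : s ≠ s + 2 := by clear * -; revert s; decide
  have n3 : s + 1 ≠ s + 2 := by clear * -; revert s; decide
  change arcWeight _ + ∑ i ∈ ring P p, y i * (u i + w i - 1) = 0
  unfold arcWeight
  rw [← hx, hsum1, hsum2]
  -- For an arc of k neighbours the sums of `x` and `y` give k edges and `htri` gives k - 1
  -- triangles, so the total is 1 - k + (k - 1) = 0.
  rcases hs with hs | hs | hs
  · have hx1 := x0 (s + 1) (by rw [hs]; clear * -; revert s; decide)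
    have hu1 := u0 s (by rw [hs]; clear * -; revert s; decide)
    have hw1 := w0 s (by rw [hs]; clear * -; revert s; decide)
    have hy1 := hxy s (by simp [hs])
    rw [hs]
    simp only [Finset.sum_singleton, hx1, hu1, hw1, hy1]
    ring
  · have hx1 := x0 (s + 2) (by rw [hs]; clear * -; revert s; decide)
    have hu1 := u0 (s + 1) (by rw [hs]; clear * -; revert s; decide)
    have hw1 := w0 s (by rw [hs]; clear * -; revert s; decide)
    have hy0 := hxy s (by simp [hs])
    have hy1 := hxy (s + 1) (by simp [hs])
    have ht := htri s (by simp [hs]) (by simp [hs])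
    rw [hs, Finset.sum_pair n1, Finset.sum_pair n1, Finset.sum_pair n1]
    rw [e2, hx1, hu1, hw1]
    linear_combination ht - hy0 - hy1
  · have hx1 := x0 (s + 3) (by rw [hs]; clear * -; revert s; decide)
    have hu1 := u0 (s + 2) (by rw [hs]; clear * -; revert s; decide)
    have hw1 := w0 s (by rw [hs]; clear * -; revert s; decide)
    have hy0 := hxy s (by simp [hs])
    have hy1 := hxy (s + 1) (by simp [hs])
    have hy2 := hxy (s + 2) (by simp [hs])
    have ht := htri s (by simp [hs]) (by simp [hs])
    have ht' := htri (s + 1) (by simp [hs]) (by simp [hs, e2])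
    have hn : s ∉ ({s + 1, s + 2} : Finset (ZMod 6)) := by simp [n1, n2]
    rw [hs, Finset.sum_insert hn, Finset.sum_insert hn, Finset.sum_insert hn,
      Finset.sum_pair n3, Finset.sum_pair n3, Finset.sum_pair n3]
    rw [e2] at ht' ⊢
    rw [e3, hx1, hu1, hw1]
    linear_combination ht + ht' - hy0 - hy1 - hy2

/-- An orientation without cyclic triangles counts the Euler characteristic of a simply connected
system. -/
theorem SimplyConnected.sum_arcWeight {P : Finset Node} {D : Node → Node → Prop}
    (hP : SimplyConnected P) (hD : TriangleAcyclic P D) :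
    ∑ q ∈ P, arcWeight (outDirs P D q) = 1 := by
  revert hD
  refine hP.erosion_induction (M := fun P => TriangleAcyclic P D →
    ∑ q ∈ P, arcWeight (outDirs P D q) = 1) (fun p _ => ?_) fun P p hp ih hD => ?_
  · have : outDirs {p} D p = ∅ := by
      ext i
      simp [mem_outDirs, add_step_ne, -add_eq_left]
    rw [Finset.sum_singleton, this, arcWeight_empty]
  · have h1 := ih (hD.mono (Finset.erase_subset _ _))
    have h2 := sum_arcWeight_sub P D p
    have h3 := hp.arcWeight_add_sum hD
    rw [Finset.sum_sub_distrib] at h2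
    rw [← Finset.add_sum_erase P _ hp.1]
    linarith

/-- If all sets of outgoing directions are empty or short arcs, then exactly one is empty. -/
theorem SimplyConnected.existsUnique_outDirs_eq_empty {P : Finset Node}
    {D : Node → Node → Prop} (hP : SimplyConnected P) (hD : TriangleAcyclic P D)
    (harc : ∀ p ∈ P, outDirs P D p = ∅ ∨ ShortArc (outDirs P D p)) :
    ∃! p, p ∈ P ∧ outDirs P D p = ∅ := by
  have hsum := hP.sum_arcWeight hD
  have hcard : ((P.filter fun p => outDirs P D p = ∅).card : ℤ) = 1 := by
    rw [Finset.card_filter, ← hsum]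
    push_cast
    refine Finset.sum_congr rfl fun p hp => ?_
    rcases harc p hp with h | h
    · simp [h, arcWeight_empty]
    · have : outDirs P D p ≠ ∅ := by
        obtain ⟨s, h | h | h⟩ := h <;> simp [h]
      simp [this, h.arcWeight_eq_zero]
  obtain ⟨p, hp⟩ := Finset.card_eq_one.1 (by exact_mod_cast hcard)
  have key : ∀ q, q ∈ P ∧ outDirs P D q = ∅ ↔ q = p := fun q => by
    have h := Finset.ext_iff.1 hp q
    rwa [Finset.mem_filter, Finset.mem_singleton] at h
  exact ⟨p, (key p).2 rfl, fun q hq => (key q).1 hq⟩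

/-! ### An acyclic orientation -/

/-- Reinserting an erodible `p` with the lowest rank makes all its neighbours outgoing, and these
form a short arc; no other particle gains an outgoing direction. -/
theorem SimplyConnected.exists_rank {P : Finset Node} (hP : SimplyConnected P) :
    ∃ ρ : Node → ℕ, Set.InjOn ρ P ∧ ∀ p ∈ P,
      outDirs P (fun u v => ρ u < ρ v) p = ∅ ∨ ShortArc (outDirs P (fun u v => ρ u < ρ v) p) := by
  refine hP.erosion_induction (M := fun P => ∃ ρ : Node → ℕ, Set.InjOn ρ P ∧ ∀ p ∈ P,
    outDirs P (fun u v => ρ u < ρ v) p = ∅ ∨ ShortArc (outDirs P (fun u v => ρ u < ρ v) p))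
    (fun p => ⟨fun _ => 0, by simp, fun q _ => Or.inl ?_⟩) ?_
  · ext i
    simp [mem_outDirs]
  · rintro P p hp ⟨ρ, hinj, harc⟩
    have hρp : Function.update (fun q => ρ q + 1) p 0 p = 0 := by simp
    have hρ : ∀ q, q ≠ p → Function.update (fun q => ρ q + 1) p 0 q = ρ q + 1 := fun q hq => by
      simp [hq]
    generalize Function.update (fun q => ρ q + 1) p 0 = σ at hρp hρ
    refine ⟨σ, ?_, fun q hq => ?_⟩
    · intro a ha b hb hab
      by_cases hap : a = p <;> by_cases hbp : b = p
      · rw [hap, hbp]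
      · rw [hap, hρp, hρ b hbp] at hab; omega
      · rw [hbp, hρp, hρ a hap] at hab; omega
      · rw [hρ a hap, hρ b hbp] at hab
        exact hinj (Finset.mem_coe.2 (Finset.mem_erase.2 ⟨hap, ha⟩))
          (Finset.mem_coe.2 (Finset.mem_erase.2 ⟨hbp, hb⟩)) (by omega)
    · by_cases hqp : q = p
      · subst hqp
        right
        convert hp.2 using 1
        ext i
        rw [mem_outDirs, mem_ring, hρp, hρ _ (add_step_ne q i)]
        simp
      · convert harc q (Finset.mem_erase.2 ⟨hqp, hq⟩) using 2 <;>
        · ext i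
          rw [mem_outDirs, mem_outDirs, Finset.mem_erase, hρ q hqp]
          by_cases hi : q + step i = p
          · simp [hi, hρp]
          · simp [hi, hρ _ hi]

/-! ### Port labellings -/

/-- A cyclic numbering of the neighbours of a node is a rotation of the standard one, up to
chirality. -/
theorem exists_rotation {q : Node} {h : ZMod 6 → Node} (hinj : Function.Injective h)
    (hadj : ∀ i, triGrid.Adj q (h i)) (hcons : ∀ i, triGrid.Adj (h i) (h (i + 1))) :
    ∃ c ε : ZMod 6, (ε = 1 ∨ ε = -1) ∧ ∀ i, h i = q + step (c + ε * i) := by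
  choose g hg using fun i => adj_iff_step.1 (hadj i)
  have hstep : ∀ i, g (i + 1) = g i + 1 ∨ g (i + 1) = g i - 1 := fun i => by
    have := hcons i
    rwa [hg i, hg (i + 1), adj_steps_iff] at this
  have hgne : ∀ i j, i ≠ j → g i ≠ g j := fun i j hij hgij =>
    hij (hinj (by rw [hg i, hg j, hgij]))
  obtain ⟨ε, hε, h0⟩ : ∃ ε : ZMod 6, (ε = 1 ∨ ε = -1) ∧ g (0 + 1) = g 0 + ε := by
    rcases hstep 0 with h | h
    · exact ⟨1, Or.inl rfl, h⟩
    · exact ⟨-1, Or.inr rfl, h.trans (sub_eq_add_neg _ _)⟩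
  have hnat : ∀ n : ℕ, g n = g 0 + ε * n ∧ g (n + 1) = g n + ε := by
    intro n
    induction n with
    | zero => simpa using h0
    | succ n ih =>
      obtain ⟨ih1, ih2⟩ := ih
      -- Injectivity forbids turning back, so the first step fixes the sense of rotation for good.
      have hne : g (n + 1 + 1) ≠ g n := hgne _ _ (by
        generalize (n : ZMod 6) = m; revert m; decide)
      push_cast
      refine ⟨by rw [ih2, ih1]; ring, ?_⟩
      rcases hε with rfl | rfl
      · refine (hstep (n + 1)).resolve_right fun h => hne ?_
        rw [h, ih2]; ring
      · have := (hstep (n + 1)).resolve_left fun h => hne (by rw [h, ih2]; ring)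
        rw [this]; ring
  refine ⟨g 0, ε, hε, fun i => ?_⟩
  have := (hnat i.val).1
  rw [ZMod.natCast_zmod_val] at this
  rw [hg i, this]

/-- For `ε = -1` the arc is reversed, and the image of its last element becomes the new start. -/
theorem ShortArc.image_affine {A : Finset (ZMod 6)} (hA : ShortArc A) {c ε : ZMod 6}
    (hε : ε = 1 ∨ ε = -1) : ShortArc (A.image fun i => c + ε * i) := by
  obtain ⟨s, rfl | rfl | rfl⟩ := hA <;> simp only [Finset.image_insert, Finset.image_singleton]
  · exact ⟨_, Or.inl rfl⟩
  · rcases hε with rfl | rfl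
    · refine ⟨c + s, Or.inr (Or.inl ?_)⟩
      congr 1 <;> ring_nf
    · refine ⟨c - s - 1, Or.inr (Or.inl ?_)⟩
      rw [Finset.pair_comm]
      congr 1 <;> ring_nf
  · rcases hε with rfl | rfl
    · refine ⟨c + s, Or.inr (Or.inr ?_)⟩
      ring_nf
    · refine ⟨c - s - 2, Or.inr (Or.inr ?_)⟩
      have h1 : c + -1 * s = c - s - 2 + 2 := by ring
      have h2 : c + -1 * (s + 1) = c - s - 2 + 1 := by ring
      have h3 : c + -1 * (s + 2) = c - s - 2 := by ring
      rw [h1, h2, h3]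
      ext i
      simp only [Finset.mem_insert, Finset.mem_singleton]
      tauto

/-- An affine bijection of `ZMod 6` preserves short arcs. -/
theorem empty_or_shortArc_iff_of_affine {A B : Finset (ZMod 6)} {c ε : ZMod 6}
    (hε : ε = 1 ∨ ε = -1) (hAB : ∀ i, c + ε * i ∈ B ↔ i ∈ A) :
    (B = ∅ ∨ ShortArc B) ↔ (A = ∅ ∨ ShortArc A) := by
  have hsq : ε * ε = 1 := by rcases hε with rfl | rfl <;> rfl
  have hinv : ∀ j, c + ε * (-(ε * c) + ε * j) = j := fun j => by
    linear_combination (j - c) * hsq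
  have hinv' : ∀ i, -(ε * c) + ε * (c + ε * i) = i := fun i => by
    linear_combination i * hsq
  have hB : B = A.image fun i => c + ε * i := by
    ext j
    rw [Finset.mem_image]
    constructor
    · exact fun hj => ⟨-(ε * c) + ε * j, (hAB _).1 (by rwa [hinv]), hinv j⟩
    · rintro ⟨i, hi, rfl⟩
      exact (hAB i).2 hi
  have hA : A = B.image fun j => -(ε * c) + ε * j := by
    rw [hB, Finset.image_image]
    ext i
    simp [hinv']
  constructor
  · rintro (h | h)
    · exact Or.inl (by rw [hA, h, Finset.image_empty])
    · exact Or.inr (hA ▸ h.image_affine hε)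
  · rintro (h | h)
    · exact Or.inl (by rw [hB, h, Finset.image_empty])
    · exact Or.inr (hB ▸ h.image_affine hε)

theorem PortLabelling.exists_rotation (L : PortLabelling) (p : Node) :
    ∃ c ε : ZMod 6, (ε = 1 ∨ ε = -1) ∧ ∀ i, L.port p i = p + step (c + ε * i) :=
  _root_.exists_rotation (L.injective p) (L.adj p) (L.consecutive p)

theorem marksOut_port {L : PortLabelling} {C : Registers} {p : Node} {i : ZMod 6} :
    MarksOut L C p (L.port p i) ↔ C p i = Link.outgoing := by
  constructor
  · rintro ⟨j, hj, h⟩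
    rwa [← L.injective p hj]
  · exact fun h => ⟨i, rfl, h⟩

theorem MarksOut.adj {L : PortLabelling} {C : Registers} {p v : Node} (h : MarksOut L C p v) :
    triGrid.Adj p v := by
  obtain ⟨i, rfl, _⟩ := h
  exact L.adj p i

theorem mem_outPorts {P : Finset Node} {L : PortLabelling} {C : Registers} {p : Node}
    {i : ZMod 6} :
    i ∈ outPorts P L C p ↔ L.port p i ∈ P ∧ MarksOut L C p (L.port p i) := by
  simp [outPorts, marksOut_port]

theorem exists_lt_two_iff {q : ℕ → Prop} : (∃ j < 2, q j) ↔ q 0 ∨ q 1 := by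
  rw [Nat.exists_lt_succ_right]
  simp

theorem exists_lt_three_iff {q : ℕ → Prop} : (∃ j < 3, q j) ↔ q 0 ∨ q 1 ∨ q 2 := by
  rw [Nat.exists_lt_succ_right, exists_lt_two_iff, or_assoc]

/-- At most three consecutive ports: none or a short arc. -/
theorem atMostThree_and_consecutive_iff {P : Finset Node} {L : PortLabelling} {C : Registers}
    {p : Node} : RuleAtMostThree P L C p ∧ RuleConsecutive P L C p ↔
      outPorts P L C p = ∅ ∨ ShortArc (outPorts P L C p) := by
  unfold RuleAtMostThree RuleConsecutive
  generalize outPorts P L C p = A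
  constructor
  · rintro ⟨hcard, s, k, hk⟩
    have hmem : ∀ j : ℕ, j < k → s + j ∈ A := fun j hj => (hk _).2 ⟨j, hj, rfl⟩
    -- The length `k` in R3 is an arbitrary natural number; from 4 on it would yield four distinct
    -- ports.
    have hk4 : k < 4 := by
      by_contra! h4
      have hsub : ({s, s + 1, s + 2, s + 3} : Finset (ZMod 6)) ⊆ A := by
        have h0 := hmem 0 (by omega)
        have h1 := hmem 1 (by omega)
        have h2 := hmem 2 (by omega)
        have h3 := hmem 3 (by omega)
        push_cast at h0 h1 h2 h3
        rw [add_zero] at h0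
        simp [Finset.insert_subset_iff, h0, h1, h2, h3]
      have h4' : ({s, s + 1, s + 2, s + 3} : Finset (ZMod 6)).card = 4 := by
        clear * -; revert s; decide
      have := Finset.card_le_card hsub
      omega
    interval_cases k
    · left
      ext i
      simp [hk]
    · refine Or.inr ⟨s, Or.inl ?_⟩
      ext i
      simp [hk]
    · refine Or.inr ⟨s, Or.inr (Or.inl ?_)⟩
      ext i
      rw [hk, exists_lt_two_iff]
      simp
    · refine Or.inr ⟨s, Or.inr (Or.inr ?_)⟩
      ext i
      simp [hk, exists_lt_three_iff]
  · rintro (rfl | ⟨s, rfl | rfl | rfl⟩)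
    · exact ⟨by simp, 0, 0, by simp⟩
    · exact ⟨by simp, s, 1, by simp⟩
    · refine ⟨Finset.card_le_two.trans (by norm_num), s, 2, fun i => ?_⟩
      rw [exists_lt_two_iff]
      simp
    · refine ⟨Finset.card_le_three, s, 3, fun i => ?_⟩
      simp [exists_lt_three_iff]

theorem exists_affine_outDirs (P : Finset Node) (L : PortLabelling) (C : Registers) (p : Node) :
    ∃ c ε : ZMod 6, (ε = 1 ∨ ε = -1) ∧
      ∀ i, c + ε * i ∈ outDirs P (MarksOut L C) p ↔ i ∈ outPorts P L C p := by
  obtain ⟨c, ε, hε, h⟩ := L.exists_rotation p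
  exact ⟨c, ε, hε, fun i => by rw [mem_outDirs, mem_outPorts, h]⟩

/-- This removes the private port numberings: R2 and R3 become a condition on absolute grid
directions. -/
theorem empty_or_shortArc_outDirs_iff {P : Finset Node} {L : PortLabelling} {C : Registers}
    {p : Node} : (outDirs P (MarksOut L C) p = ∅ ∨ ShortArc (outDirs P (MarksOut L C) p)) ↔
      RuleAtMostThree P L C p ∧ RuleConsecutive P L C p := by
  obtain ⟨c, ε, hε, h⟩ := exists_affine_outDirs P L C p
  rw [atMostThree_and_consecutive_iff, empty_or_shortArc_iff_of_affine hε h]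

theorem outDirs_eq_empty_iff {P : Finset Node} {L : PortLabelling} {C : Registers} {p : Node} :
    outDirs P (MarksOut L C) p = ∅ ↔ outPorts P L C p = ∅ := by
  simp only [Finset.eq_empty_iff_forall_notMem, mem_outDirs, mem_outPorts]
  constructor
  · intro h i hi
    obtain ⟨j, hj⟩ := adj_iff_step.1 (L.adj p i)
    exact h j (hj ▸ hi)
  · rintro h i ⟨hi, j, hj, hC⟩
    exact h j ⟨hj ▸ hi, marksOut_port.2 hC⟩

/-! ### Soundness -/

theorem Valid.triangleAcyclic {P : Finset Node} {L : PortLabelling} {C : Registers}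
    (h : Valid P L C) : TriangleAcyclic P (MarksOut L C) := by
  have hor : ∀ u ∈ P, ∀ v ∈ P, triGrid.Adj u v → (MarksOut L C u v ↔ ¬ MarksOut L C v u) := by
    intro u hu v hv huv
    rcases (h u hu).1 v hv huv with h | h
    · exact iff_of_true h.2.2.2.1 h.2.2.2.2
    · exact iff_of_false h.2.2.2.2 (not_not.2 h.2.2.2.1)
  refine ⟨hor, fun u hu v hv w hw huv hvw hwu hcyc => ?_⟩
  exact (h u hu).2.2.2 v w ⟨⟨hu, hv, huv, hcyc.1, (hor u hu v hv huv).1 hcyc.1⟩,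
    ⟨hv, hw, hvw, hcyc.2.1, (hor v hv w hw hvw).1 hcyc.2.1⟩,
    ⟨hw, hu, hwu, hcyc.2.2, (hor w hw u hu hwu).1 hcyc.2.2⟩⟩

theorem SimplyConnected.existsUnique_isSink {P : Finset Node} {L : PortLabelling} {C : Registers}
    (hP : SimplyConnected P) (h : Valid P L C) : ∃! p, IsSink P L C p := by
  have := hP.existsUnique_outDirs_eq_empty h.triangleAcyclic fun p hp =>
    empty_or_shortArc_outDirs_iff.2 ⟨(h p hp).2.1, (h p hp).2.2.1⟩
  simpa only [outDirs_eq_empty_iff, IsSink] using this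

/-! ### Completeness -/

/-- The certificates that direct every edge from lower to higher rank. -/
def registersOfRank (L : PortLabelling) (ρ : Node → ℕ) : Registers := fun p i =>
  if ρ p < ρ (L.port p i) then Link.outgoing else Link.incoming

theorem marksOut_registersOfRank {L : PortLabelling} {ρ : Node → ℕ} {p q : Node}
    (h : triGrid.Adj p q) : MarksOut L (registersOfRank L ρ) p q ↔ ρ p < ρ q := by
  obtain ⟨i, rfl⟩ : ∃ i, L.port p i = q := by
    obtain ⟨c, ε, hε, hL⟩ := L.exists_rotation p
    obtain ⟨j, rfl⟩ := adj_iff_step.1 h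
    refine ⟨ε * (j - c), ?_⟩
    have hsq : ε * ε = 1 := by rcases hε with rfl | rfl <;> rfl
    rw [hL, ← mul_assoc, hsq, one_mul, add_sub_cancel]
  rw [marksOut_port, registersOfRank]
  split_ifs with h <;> simp [h]

theorem SimplyConnected.exists_acyclic_registers {P : Finset Node} (hP : SimplyConnected P)
    (L : PortLabelling) :
    ∃ C : Registers, Valid P L C ∧ ∀ p, ¬ OnDirectedCycle P L C p := by
  obtain ⟨ρ, hinj, harc⟩ := hP.exists_rank
  have hlt : ∀ u v, DirectedEdge P L (registersOfRank L ρ) u v → ρ u < ρ v := fun u v h =>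
    (marksOut_registersOfRank h.2.2.1).1 h.2.2.2.1
  have hedge : ∀ u ∈ P, ∀ v ∈ P, triGrid.Adj u v → ρ u < ρ v →
      DirectedEdge P L (registersOfRank L ρ) u v := fun u hu v hv huv h =>
    ⟨hu, hv, huv, (marksOut_registersOfRank huv).2 h, fun h' =>
      absurd ((marksOut_registersOfRank huv.symm).1 h') (by omega)⟩
  refine ⟨registersOfRank L ρ, fun p hp => ⟨fun q hq hpq => ?_, ?_⟩, fun p hcyc => ?_⟩
  · rcases lt_trichotomy (ρ p) (ρ q) with h | h | h
    · exact Or.inl (hedge p hp q hq hpq h)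
    · exact absurd (hinj hp hq h) hpq.ne
    · exact Or.inr (hedge q hq p hp hpq.symm h)
  · rw [← and_assoc, ← empty_or_shortArc_outDirs_iff]
    refine ⟨?_, fun q r h => ?_⟩
    · have : outDirs P (MarksOut L (registersOfRank L ρ)) p =
          outDirs P (fun u v => ρ u < ρ v) p := by
        ext i
        rw [mem_outDirs, mem_outDirs, marksOut_registersOfRank (adj_add_step p i)]
      rw [this]
      exact harc p hp
    · have h1 := hlt _ _ h.1
      have h2 := hlt _ _ h.2.1
      have h3 := hlt _ _ h.2.2
      omega
  · have : ∀ u v, Relation.TransGen (DirectedEdge P L (registersOfRank L ρ)) u v → ρ u < ρ v := by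
      intro u v h
      induction h with
      | single h => exact hlt _ _ h
      | tail _ h ih => exact ih.trans (hlt _ _ h)
    exact lt_irrefl _ (this p p hcyc)

/-! ### Locality -/

theorem locallyValid_iff_of_sameView {φ : triGrid ≃g triGrid} {P : Finset Node}
    {L : PortLabelling} {C : Registers} {P' : Finset Node} {L' : PortLabelling} {C' : Registers}
    {p : Node} (hp : p ∈ P) (h : SameView φ P L C P' L' C' p) :
    LocallyValid P L C p ↔ LocallyValid P' L' C' (φ p) := by
  have hadj : ∀ u v, triGrid.Adj (φ u) (φ v) ↔ triGrid.Adj u v := fun u v => φ.map_rel_iff'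
  have hedge : ∀ u v, (u = p ∨ triGrid.Adj p u) → (v = p ∨ triGrid.Adj p v) →
      (DirectedEdge P L C u v ↔ DirectedEdge P' L' C' (φ u) (φ v)) := by
    intro u v hu hv
    obtain ⟨hu1, hu2⟩ := h u hu
    obtain ⟨hv1, hv2⟩ := h v hv
    unfold DirectedEdge
    rw [← hu1, ← hv1, hadj]
    refine and_congr_right fun huP => and_congr_right fun hvP => and_congr_right fun huv => ?_
    rw [hu2 huP v huv, hv2 hvP u huv.symm]
  have hp' : p = p ∨ triGrid.Adj p p := Or.inl rfl
  unfold LocallyValid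
  refine and_congr ?_ ?_
  · unfold RuleOriented
    rw [φ.surjective.forall (p := fun q => q ∈ P' → _)]
    refine forall_congr' fun q => ?_
    rw [hadj]
    constructor
    · intro H hq hpq
      have hq' : q = p ∨ triGrid.Adj p q := Or.inr hpq
      rw [← hedge p q hp' hq', ← hedge q p hq' hp']
      exact H ((h q hq').1.2 hq) hpq
    · intro H hq hpq
      have hq' : q = p ∨ triGrid.Adj p q := Or.inr hpq
      rw [hedge p q hp' hq', hedge q p hq' hp']
      exact H ((h q hq').1.1 hq) hpq
  rw [← and_assoc, ← and_assoc]
  refine and_congr ?_ ?_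
  · obtain ⟨c, ε, hε, hφ⟩ := exists_rotation (q := φ p) (h := fun i => φ (L.port p i))
      (φ.injective.comp (L.injective p)) (fun i => (hadj _ _).2 (L.adj p i))
      (fun i => (hadj _ _).2 (L.consecutive p i))
    rw [atMostThree_and_consecutive_iff, ← empty_or_shortArc_outDirs_iff (p := φ p)]
    refine (empty_or_shortArc_iff_of_affine (c := c) hε fun i => ?_).symm
    rw [mem_outDirs, mem_outPorts, ← hφ, ← (h _ (Or.inr (L.adj p i))).1,
      ← (h p hp').2 hp _ (L.adj p i)]
  · unfold RuleNoCyclicTriangle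
    rw [φ.surjective.forall (p := fun q => ∀ r, ¬ (DirectedEdge P' L' C' (φ p) q ∧ _))]
    refine forall_congr' fun q => ?_
    rw [φ.surjective.forall (p := fun r => ¬ (DirectedEdge P' L' C' _ _ ∧ _))]
    refine forall_congr' fun r => not_congr ?_
    constructor
    · rintro ⟨h1, h2, h3⟩
      have hq : q = p ∨ triGrid.Adj p q := Or.inr h1.2.2.1
      have hr : r = p ∨ triGrid.Adj p r := Or.inr h3.2.2.1.symm
      exact ⟨(hedge p q hp' hq).1 h1, (hedge q r hq hr).1 h2, (hedge r p hr hp').1 h3⟩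
    · rintro ⟨h1, h2, h3⟩
      have hq : q = p ∨ triGrid.Adj p q := Or.inr ((hadj _ _).1 h1.2.2.1)
      have hr : r = p ∨ triGrid.Adj p r := Or.inr ((hadj _ _).1 h3.2.2.1.symm)
      exact ⟨(hedge p q hp' hq).2 h1, (hedge q r hq hr).2 h2, (hedge r p hr hp').2 h3⟩

/-! ### A valid configuration with a directed cycle -/

/-- A node and its six neighbours. -/
def hexagon : Finset Node :=
  {(0, 0), (1, 0), (0, 1), (-1, 1), (-1, 0), (0, -1), (1, -1)}

/-- The port labelling that numbers the ports of all nodes in the same way. -/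
def standardLabelling : PortLabelling where
  port p i := p + step i
  injective _ _ _ h := step_injective (add_left_cancel h)
  adj := adj_add_step
  consecutive p i := (adj_steps_iff p i (i + 1)).2 (Or.inl rfl)

/-- Every node of the rim of the hexagon points to the next one and to the centre. -/
def hexagonRegisters : Registers := fun p j =>
  -- From `step k`, direction `k + 2` leads to `step (k + 1)` and direction `k + 3` to the centre.
  if ∃ k, p = step k ∧ (j = k + 2 ∨ j = k + 3) then Link.outgoing else Link.incoming

theorem mem_hexagon {v : Node} : v ∈ hexagon ↔
    -1 ≤ v.1 ∧ v.1 ≤ 1 ∧ -1 ≤ v.2 ∧ v.2 ≤ 1 ∧ -1 ≤ v.1 + v.2 ∧ v.1 + v.2 ≤ 1 := by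
  simp only [hexagon, Finset.mem_insert, Finset.mem_singleton, Prod.ext_iff]
  omega

theorem joinedWithin_row {S : Set Node} {y : ℤ} (h : ∀ x, (x, y) ∈ S) (a b : ℤ) :
    JoinedWithin S (a, y) (b, y) := by
  have key : ∀ a : ℤ, ∀ n : ℕ, JoinedWithin S (a, y) (a + n, y) := by
    intro a n
    induction n with
    | zero => simpa using JoinedWithin.refl S (a, y)
    | succ n ih =>
      refine ih.trans (JoinedWithin.of_adj ?_ (h _) (h _))
      rw [adj_iff_coords]
      push_cast
      omega
  rcases le_total a b with hab | hab
  · simpa [Int.toNat_of_nonneg (sub_nonneg.2 hab)] using key a (b - a).toNat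
  · simpa [Int.toNat_of_nonneg (sub_nonneg.2 hab)] using (key b (a - b).toNat).symm

theorem joinedWithin_column {S : Set Node} {x : ℤ} (h : ∀ y, (x, y) ∈ S) (a b : ℤ) :
    JoinedWithin S (x, a) (x, b) := by
  have key : ∀ a : ℤ, ∀ n : ℕ, JoinedWithin S (x, a) (x, a + n) := by
    intro a n
    induction n with
    | zero => simpa using JoinedWithin.refl S (x, a)
    | succ n ih =>
      refine ih.trans (JoinedWithin.of_adj ?_ (h _) (h _))
      rw [adj_iff_coords]
      push_cast
      omega
  rcases le_total a b with hab | hab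
  · simpa [Int.toNat_of_nonneg (sub_nonneg.2 hab)] using key a (b - a).toNat
  · simpa [Int.toNat_of_nonneg (sub_nonneg.2 hab)] using (key b (a - b).toNat).symm

theorem simplyConnected_hexagon : SimplyConnected hexagon := by
  rw [simplyConnected_iff]
  refine ⟨⟨⟨(0, 0), by decide⟩, ?_⟩, ?_⟩
  · have hto : ∀ u ∈ hexagon, JoinedWithin (hexagon : Set Node) u (0, 0) := by
      intro u hu
      by_cases h0 : u = (0, 0)
      · rw [h0]; exact JoinedWithin.refl _ _
      · refine JoinedWithin.of_adj ?_ hu (by decide : ((0, 0) : Node) ∈ hexagon)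
        rw [Prod.ext_iff] at h0
        rw [mem_hexagon] at hu
        rw [adj_iff_coords]
        simp only at h0 ⊢
        omega
    exact fun u hu v hv => (hto u hu).trans (hto v hv).symm
  · have hrow : ∀ y : ℤ, (y ≤ -2 ∨ 2 ≤ y) → ∀ a b : ℤ,
        JoinedWithin (hexagon : Set Node)ᶜ (a, y) (b, y) := fun y hy =>
      joinedWithin_row fun x hx => by
        have := mem_hexagon.1 hx
        simp only at this
        omega
    have hcol : ∀ x : ℤ, (x ≤ -2 ∨ 2 ≤ x) → ∀ a b : ℤ,
        JoinedWithin (hexagon : Set Node)ᶜ (x, a) (x, b) := fun x hx =>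
      joinedWithin_column fun y hy => by
        have := mem_hexagon.1 hy
        simp only at this
        omega
    have hto : ∀ u ∉ hexagon, JoinedWithin (hexagon : Set Node)ᶜ u (2, 2) := by
      rintro ⟨x, y⟩ hu
      by_cases hx : x ≤ -2 ∨ 2 ≤ x
      · exact (hcol x hx y 2).trans (hrow 2 (by omega) x 2)
      by_cases hy : y ≤ -2 ∨ 2 ≤ y
      · exact (hrow y hy x 2).trans (hcol 2 (by omega) y 2)
      -- These are the two corners of the square around the origin that the hexagon leaves out; one
      -- horizontal step leads out of the square.
      have hxy : (x = 1 ∧ y = 1) ∨ (x = -1 ∧ y = -1) := by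
        rw [mem_hexagon] at hu
        simp only at hu
        omega
      have hfar : ((2, 1) : Node) ∉ hexagon ∧ ((-2, -1) : Node) ∉ hexagon := by decide
      rcases hxy with ⟨rfl, rfl⟩ | ⟨rfl, rfl⟩
      · exact (JoinedWithin.of_adj (adj_iff_coords.2 (by simp)) hu hfar.1).trans
          (hcol 2 (by omega) 1 2)
      · exact (JoinedWithin.of_adj (adj_iff_coords.2 (by simp)) hu hfar.2).trans
          ((hcol (-2) (by omega) (-1) 2).trans (hrow 2 (by omega) (-2) 2))
    exact fun u hu v hv => (hto u hu).trans (hto v hv).symm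

instance (L : PortLabelling) (C : Registers) (p q : Node) : Decidable (MarksOut L C p q) := by
  unfold MarksOut; infer_instance

instance : DecidableRel triGrid.Adj := fun p q =>
  inferInstanceAs (Decidable (q - p ∈ gridSteps))

instance (P : Finset Node) (L : PortLabelling) (C : Registers) (p q : Node) :
    Decidable (DirectedEdge P L C p q) := by
  unfold DirectedEdge; infer_instance

/-- Every triangle contains the centre, which is a sink, so none is cyclic although the rim is. -/
theorem valid_hexagon : Valid hexagon standardLabelling hexagonRegisters := by
  intro p hp
  refine ⟨?_, ?_⟩
  · revert p; unfold RuleOriented; decide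
  · rw [← and_assoc, atMostThree_and_consecutive_iff]
    refine ⟨by revert p; decide, fun q r h => ?_⟩
    have key : ∀ p ∈ hexagon, ∀ q ∈ hexagon, ∀ r ∈ hexagon,
        ¬ (DirectedEdge hexagon standardLabelling hexagonRegisters p q ∧
          DirectedEdge hexagon standardLabelling hexagonRegisters q r ∧
          DirectedEdge hexagon standardLabelling hexagonRegisters r p) := by decide
    exact key p hp q h.1.2.1 r h.2.1.2.1 h

theorem onDirectedCycle_hexagon :
    OnDirectedCycle hexagon standardLabelling hexagonRegisters (step 0) := by
  have h : ∀ i, DirectedEdge hexagon standardLabelling hexagonRegisters (step i) (step (i + 1)) := by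
    decide
  have hn : ∀ n : ℕ, Relation.TransGen (DirectedEdge hexagon standardLabelling hexagonRegisters)
      (step 0) (step ((n + 1 : ℕ) : ZMod 6)) := by
    intro n
    induction n with
    | zero => simpa using Relation.TransGen.single (h 0)
    | succ n ih =>
      refine ih.tail ?_
      have := h ((n + 1 : ℕ) : ZMod 6)
      rwa [← Nat.cast_succ] at this
  -- After six steps the index `5 + 1` is 0 modulo 6.
  exact hn 5

theorem card_register : Nat.card Register = 2 ^ 6 := by
  have hL : Nat.card Link = 2 := by
    have e : Link ≃ Bool :=
      { toFun := fun l => decide (l = Link.outgoing)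
        invFun := fun b => if b then Link.outgoing else Link.incoming
        left_inv := by rintro (_ | _) <;> rfl
        right_inv := by rintro (_ | _) <;> rfl }
    rw [Nat.card_congr e, Nat.card_eq_fintype_card, Fintype.card_bool]
  rw [Register, Nat.card_fun, hL, Nat.card_zmod]

/-- R1–R4 form a proof-labelling scheme for leader election with certificates of constant size:
* soundness: in a simply connected system every valid configuration has exactly one sink;
* completeness: every simply connected system has a valid configuration, even an acyclic one;
* a certificate is one of `2 ^ 6` values, and whether a particle satisfies R1–R4 depends only on
  what is seen at distance at most one from it, up to symmetries of the grid;
* a valid configuration may contain directed cycles. -/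
theorem theorem1 :
    (∀ (P : Finset Node) (L : PortLabelling) (C : Registers),
      SimplyConnected P → Valid P L C → ∃! p, IsSink P L C p) ∧
    (∀ (P : Finset Node) (L : PortLabelling),
      SimplyConnected P → ∃ C : Registers, Valid P L C ∧ ∀ p, ¬ OnDirectedCycle P L C p) ∧
    Nat.card Register = 2 ^ 6 ∧
    (∀ (φ : triGrid ≃g triGrid) (P : Finset Node) (L : PortLabelling) (C : Registers)
      (P' : Finset Node) (L' : PortLabelling) (C' : Registers) (p : Node),
      p ∈ P → SameView φ P L C P' L' C' p →
        (LocallyValid P L C p ↔ LocallyValid P' L' C' (φ p))) ∧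
    (∃ (P : Finset Node) (L : PortLabelling) (C : Registers) (p : Node),
      SimplyConnected P ∧ Valid P L C ∧ OnDirectedCycle P L C p) := by
  exact ⟨fun P L C hP h => hP.existsUnique_isSink h,
    fun P L hP => hP.exists_acyclic_registers L, card_register,
    fun φ P L C P' L' C' p hp h => locallyValid_iff_of_sameView hp h,
    hexagon, standardLabelling, hexagonRegisters, step 0, simplyConnected_hexagon, valid_hexagon,
    onDirectedCycle_hexagon⟩
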